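/- **Setting.** Let $A_0,A_1$ be real $2\times2$ matrices and fix any norm $\|\cdot\|$ on the space of real $2\times 2$ matrices. Write $\rho(M)$ for the spectral radius of $M$ (the maximum modulus of its complex eigenvalues). For $\alpha\ge 0$ put $A_0^{(\alpha)}:=A_0$, $A_1^{(\alpha)}:=\alpha A_1$ and let $$\varrho(\alpha):=\lim_{n\to\infty}\max\left\{\left\|A^{(\alpha)}_{i_n}\cdots A^{(\alpha)}_{i_1}\right\|^{1/n}: i_1,\dots,i_n\in\{0,1\}\right\}$$ be the joint spectral radius of $\{A_0,\alpha A_1\}$. For a finite word $u=u_1\cdots u_m$ over $\{0,1\}$ let $\mathcal A_\alpha(u):=A^{(\alpha)}_{u_m}\cdots A^{(\alpha)}_{u_1}$; for an infinite word $x\in\{0,1\}^{\mathbb N}$ let $\mathcal A_\alpha(x,n):=\mathcal A_\alpha(x_1\cdots x_n)$; put $\mathcal A:=\mathcal A_1$. Write $|u|$ for the length of $u$, $|u|_1$ for its number of ones, and, if $u$ is nonempty, $\varsigma(u):=|u|_1/|u|$ for its slope. A finite word $u$ is *balanced* if $\bigl||v|_1-|w|_1\bigr|\le 1$ for all subwords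 (blocks of consecutive letters) $v,w$ of $u$ of equal length, and *cyclically balanced* if all its cyclic permutations, including $u$ itself, are balanced. For $\gamma\in[0,1]$ let $X_\gamma$ be the set of all $x\in\{0,1\}^{\mathbb N}$ for which there is $\delta\in\mathbb R$ such that either $x_n=\lfloor\gamma(n+1)+\delta\rfloor-\lfloor\gamma n+\delta\rfloor$ for all $n$, or $x_n=\lceil\gamma(n+1)+\delta\rceil-\lceil\gamma n+\delta\rceil$ for all $n$. An infinite word $x$ is *weakly extremal* for $\{A_0,\alpha A_1\}$ if $\|\mathcal A_\alpha(x,n)\|^{1/n}\to\varrho(\alpha)$. Assume the *technical hypotheses*: $A_0$ and $A_1$ are entrywise non-negative, invertible, have positive trace and have no common invariant subspace other than $\{0\}$ and $\mathbb R^2$; and all entries of $\mathcal A(u)$ are positive for every finite word $u$ that is not of the form $0^n$ or $1^n$ ($n\geq 0$). Assume also the *Sturmian hypothesis*: there is a function $\mathfrak r:[0,\infty)\to[0,1]$ such that for every $\alpha\ge0$ * every $x\in X_{\mathfrak r(\alpha)}$ is weakly extremal for $\{A_0,\alpha A_1\}$; * if $x$ is weakly extremal for $\{A_0,\alpha A_1\}$,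 then $\frac1n\#\{1\le i\le n:x_i=1\}\to\mathfrak r(\alpha)$; * if a finite word $u$ is not cyclically balanced, then $\rho(\mathcal A_\alpha(u))<\varrho(\alpha)^{|u|}$. **Proposition 3.3.** There exists a continuous concave function $S:[0,1]\to\mathbb R$ with the following properties. 1. For each $\gamma\in[0,1]$ and every $x\in X_\gamma$, $\ \frac1n\log\|\mathcal A(x,n)\|\to S(\gamma)$ as $n\to\infty$. 2. For each $\alpha\in[0,\infty)$ and $\gamma\in[0,1]$, $\ e^{S(\gamma)}\alpha^\gamma\le\varrho(\alpha)$ (with $0^0=1$), with equality if and only if $\gamma=\mathfrak r(\alpha)$. Moreover, for each $\alpha>0$ and $\gamma\in[0,1]$, $\ \mathfrak r(\alpha)=\gamma$ if and only if $-\log\alpha$ is a subgradient of $S$ at $\gamma$, that is, $S(t)\le S(\gamma)-(t-\gamma)\log\alpha$ for all $t\in[0,1]$. 3. If $k,q\ge1$ and $p\ge0$ are integers and $u$ is a finite word of length $kq$ with $\varsigma(u)=p/q$, then $\frac1{kq}\log\rho(\mathcal A(u))\le S(p/q)$, with equality if and only if $u$ is cyclically balanced. -/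

import Mathlib

open Filter Topology

namespace SturmianPair

/-- Real `2 × 2` matrices. -/
abbrev Mat2 : Type := Matrix (Fin 2) (Fin 2) ℝ

/-! ### Words -/

/-- Finite words over `{0,1}`; the word `u₁ u₂ … uₘ` is the list `[u₁, u₂, …, uₘ]`. -/
abbrev Word : Type := List (Fin 2)

/-- Infinite words over `{0,1}`; the letter `x_{n+1}` (letters numbered from one) is `x n`. -/
abbrev InfWord : Type := ℕ → Fin 2

/-- The number of letters of `u` equal to `1`. -/
def ones (u : Word) : ℕ := u.count 1

/-- The slope of a (nonempty) word: the proportion of letters equal to `1`. -/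
noncomputable def slope (u : Word) : ℝ := (ones u : ℝ) / (u.length : ℝ)

/-- The prefix of length `n` of an infinite word. -/
def pre (x : InfWord) (n : ℕ) : Word := List.ofFn fun i : Fin n => x i

/-- A finite word is balanced if any two subwords (blocks of consecutive letters) of the same
length have numbers of ones that differ by at most one. -/
def Balanced (u : Word) : Prop :=
  ∀ v w : Word, v <:+: u → w <:+: u → v.length = w.length →
    |(ones v : ℤ) - (ones w : ℤ)| ≤ 1

/-- A finite word is cyclically balanced if all its cyclic permutations (itself included) are
balanced. -/
def CyclicallyBalanced (u : Word) : Prop :=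
  ∀ v : Word, u ~r v → Balanced v

/-- The set `X_γ` of rotation words of slope `γ`. Numbering the letters from zero instead of one
only changes the free parameter `δ` by `γ`. -/
def X (γ : ℝ) : Set InfWord :=
  {x | ∃ δ : ℝ,
    (∀ n : ℕ, (((x n : Fin 2) : ℕ) : ℤ) = ⌊γ * ((n : ℝ) + 1) + δ⌋ - ⌊γ * (n : ℝ) + δ⌋) ∨
    (∀ n : ℕ, (((x n : Fin 2) : ℕ) : ℤ) = ⌈γ * ((n : ℝ) + 1) + δ⌉ - ⌈γ * (n : ℝ) + δ⌉)}

/-! ### Matrix products and spectral radii -/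

/-- The product `B_{u_m} ⋯ B_{u_1}` along the word `u = u_1 … u_m`. -/
def wordProd (B : Fin 2 → Mat2) (u : Word) : Mat2 := (u.map B).reverse.prod

/-- The product `B_{x_n} ⋯ B_{x_1}` along the prefix of length `n` of `x`. -/
def seqProd (B : Fin 2 → Mat2) (x : InfWord) (n : ℕ) : Mat2 := wordProd B (pre x n)

/-- The spectral radius of a real matrix: the maximum of the moduli of its complex eigenvalues. -/
noncomputable def specRad (M : Mat2) : ℝ :=
  (spectralRadius ℂ (M.map (fun t : ℝ => (t : ℂ)))).toReal

/-- The joint spectral radius of the pair `B`, computed with the norm `N`: the limit of the maximum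
of `N (B_{i_n} ⋯ B_{i_1}) ^ (1 / n)` over all index words of length `n`. -/
noncomputable def jointSpecRad (N : Seminorm ℝ Mat2) (B : Fin 2 → Mat2) : ℝ :=
  limUnder atTop fun n : ℕ =>
    (Finset.univ : Finset (Fin n → Fin 2)).sup' Finset.univ_nonempty
      fun w => N (wordProd B (List.ofFn w)) ^ (1 / (n : ℝ))

/-- The infinite word `x` is weakly extremal for the pair `B`. -/
def WeaklyExtremal (N : Seminorm ℝ Mat2) (B : Fin 2 → Mat2) (x : InfWord) : Prop :=
  Tendsto (fun n : ℕ => N (seqProd B x n) ^ (1 / (n : ℝ))) atTop (𝓝 (jointSpecRad N B))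

/-- The pair `{A₀, α A₁}`. -/
noncomputable def scaled (A : Fin 2 → Mat2) (α : ℝ) : Fin 2 → Mat2 := ![A 0, α • A 1]

/-! ### Hypotheses on the pair -/

/-- The technical hypotheses. -/
structure TechnicalHypotheses (A : Fin 2 → Mat2) : Prop where
  nonneg : ∀ k i j, 0 ≤ A k i j
  invertible : ∀ k, IsUnit (A k)
  trace_pos : ∀ k, 0 < (A k).trace
  no_common_invariant : ∀ V : Submodule ℝ (Fin 2 → ℝ),
    (∀ k, ∀ v ∈ V, (A k).mulVec v ∈ V) → V = ⊥ ∨ V = ⊤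
  pos_of_mixed : ∀ u : Word,
    (∀ n : ℕ, u ≠ List.replicate n 0 ∧ u ≠ List.replicate n 1) →
      ∀ i j, 0 < wordProd A u i j

/-- The Sturmian hypothesis, satisfied with the function `r : [0,∞) → [0,1]` (only the values of
`r` on `[0,∞)` matter): `r` is the `1`-ratio function of the pair `A`. -/
structure IsOneRatioFunction (N : Seminorm ℝ Mat2) (A : Fin 2 → Mat2) (r : ℝ → ℝ) : Prop where
  mem_Icc : ∀ α : ℝ, 0 ≤ α → r α ∈ Set.Icc (0 : ℝ) 1
  extremal : ∀ α : ℝ, 0 ≤ α → ∀ x ∈ X (r α), WeaklyExtremal N (scaled A α) x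
  ratio : ∀ α : ℝ, 0 ≤ α → ∀ x : InfWord, WeaklyExtremal N (scaled A α) x →
    Tendsto (fun n : ℕ => (ones (pre x n) : ℝ) / (n : ℝ)) atTop (𝓝 (r α))
  lt_of_not_balanced : ∀ α : ℝ, 0 ≤ α → ∀ u : Word, ¬ CyclicallyBalanced u →
    specRad (wordProd (scaled A α) u) < jointSpecRad N (scaled A α) ^ u.length

/-- `l` is a subgradient at `γ` of the concave function `S` on `[0,1]`. -/
def IsSubgradient (S : ℝ → ℝ) (γ l : ℝ) : Prop :=
  ∀ t ∈ Set.Icc (0 : ℝ) 1, S t ≤ S γ + l * (t - γ)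

end SturmianPair

namespace SturmianPair

/-! ### Prefixes and shifts -/

/-- The infinite word obtained by deleting the first `k` letters. -/
def shift (k : ℕ) (x : InfWord) : InfWord := fun n => x (k + n)

@[simp] lemma length_pre (x : InfWord) (n : ℕ) : (pre x n).length = n := by simp [pre]

lemma pre_add (x : InfWord) (k m : ℕ) : pre x (k + m) = pre x k ++ pre (shift k x) m := by
  simp [pre, List.ofFn_add, shift]

lemma shift_shift (x : InfWord) (a b : ℕ) : shift b (shift a x) = shift (a + b) x := by
  funext n; simp [shift, add_assoc]

lemma ones_append (u v : Word) : ones (u ++ v) = ones u + ones v := by simp [ones]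

lemma ones_le_length (u : Word) : ones u ≤ u.length := List.count_le_length

lemma ones_pre_add (x : InfWord) (k m : ℕ) :
    ones (pre x (k + m)) = ones (pre x k) + ones (pre (shift k x) m) := by
  rw [pre_add, ones_append]

lemma ones_pre_succ (x : InfWord) (n : ℕ) :
    ones (pre x (n + 1)) = ones (pre x n) + (x n : ℕ) := by
  rw [ones_pre_add]
  congr 1
  have : ∀ a : Fin 2, List.count 1 [a] = (a : ℕ) := by decide
  simpa [pre, shift, ones] using this (x n)

lemma eq_replicate_zero {u : Word} (h : ones u = 0) : u = List.replicate u.length 0 := by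
  refine List.eq_replicate_iff.2 ⟨rfl, fun b hb => ?_⟩
  have : (1 : Fin 2) ∉ u := List.count_eq_zero.1 h
  have hb1 : b ≠ 1 := fun h => this (h ▸ hb)
  omega

lemma eq_replicate_one {u : Word} (h : ones u = u.length) : u = List.replicate u.length 1 :=
  List.eq_replicate_iff.2 ⟨rfl, fun b hb => (List.count_eq_length.1 h b hb).symm⟩

/-! ### Rotation words -/

lemma X_nonempty {γ : ℝ} (h : γ ∈ Set.Icc (0 : ℝ) 1) : (X γ).Nonempty := by
  have key : ∀ n : ℕ, ∃ a : Fin 2,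
      (((a : Fin 2) : ℕ) : ℤ) = ⌊γ * ((n : ℝ) + 1) + 0⌋ - ⌊γ * (n : ℝ) + 0⌋ := by
    intro n
    have h1 : ⌊γ * (n : ℝ) + 0⌋ ≤ ⌊γ * ((n : ℝ) + 1) + 0⌋ :=
      Int.floor_le_floor (by nlinarith [h.1])
    have h2 : ⌊γ * ((n : ℝ) + 1) + 0⌋ ≤ ⌊γ * (n : ℝ) + 0 + 1⌋ :=
      Int.floor_le_floor (by nlinarith [h.2])
    rw [Int.floor_add_one] at h2
    rcases (by omega : ⌊γ * ((n : ℝ) + 1) + 0⌋ - ⌊γ * (n : ℝ) + 0⌋ = 0 ∨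
      ⌊γ * ((n : ℝ) + 1) + 0⌋ - ⌊γ * (n : ℝ) + 0⌋ = 1) with h | h
    · exact ⟨0, by rw [h]; rfl⟩
    · exact ⟨1, by rw [h]; rfl⟩
  choose x hx using key
  exact ⟨x, 0, Or.inl hx⟩

lemma shift_mem_X {γ : ℝ} {x : InfWord} (hx : x ∈ X γ) (k : ℕ) : shift k x ∈ X γ := by
  obtain ⟨δ, hδ⟩ := hx
  refine ⟨γ * k + δ, hδ.imp (fun h n => ?_) (fun h n => ?_)⟩
  all_goals
    rw [shift, h]
    push_cast
    congr 2 <;> ring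

lemma abs_ones_sub_le {γ : ℝ} {x : InfWord} (hx : x ∈ X γ) (n : ℕ) :
    |(ones (pre x n) : ℝ) - γ * n| ≤ 1 := by
  obtain ⟨δ, h | h⟩ := hx
  · have key : ∀ n : ℕ, ((ones (pre x n) : ℕ) : ℤ) = ⌊γ * (n : ℝ) + δ⌋ - ⌊δ⌋ := by
      intro n
      induction n with
      | zero => simp [pre, ones]
      | succ n ih => rw [ones_pre_succ]; push_cast; rw [ih, h]; ring
    have h1 : (ones (pre x n) : ℝ) = (⌊γ * (n : ℝ) + δ⌋ : ℝ) - ⌊δ⌋ := by exact_mod_cast key n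
    rw [h1, abs_le]
    constructor <;> linarith [Int.floor_le (γ * n + δ), Int.lt_floor_add_one (γ * n + δ),
      Int.floor_le δ, Int.lt_floor_add_one δ]
  · have key : ∀ n : ℕ, ((ones (pre x n) : ℕ) : ℤ) = ⌈γ * (n : ℝ) + δ⌉ - ⌈δ⌉ := by
      intro n
      induction n with
      | zero => simp [pre, ones]
      | succ n ih => rw [ones_pre_succ]; push_cast; rw [ih, h]; ring
    have h1 : (ones (pre x n) : ℝ) = (⌈γ * (n : ℝ) + δ⌉ : ℝ) - ⌈δ⌉ := by exact_mod_cast key n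
    rw [h1, abs_le]
    constructor <;> linarith [Int.le_ceil (γ * n + δ), Int.ceil_lt_add_one (γ * n + δ),
      Int.le_ceil δ, Int.ceil_lt_add_one δ]

lemma tendsto_ratio {γ : ℝ} {x : InfWord}
    (hx : ∀ n : ℕ, |(ones (pre x n) : ℝ) - γ * n| ≤ 1) :
    Tendsto (fun n : ℕ => (ones (pre x n) : ℝ) / n) atTop (𝓝 γ) := by
  rw [tendsto_iff_norm_sub_tendsto_zero]
  refine squeeze_zero' (Eventually.of_forall fun n => norm_nonneg _) ?_
    tendsto_one_div_atTop_nhds_zero_nat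
  filter_upwards [eventually_gt_atTop 0] with n hn
  have hn' : (0 : ℝ) < n := by exact_mod_cast hn
  have : (ones (pre x n) : ℝ) / n - γ = (ones (pre x n) - γ * n) / n := by field_simp
  rw [this, Real.norm_eq_abs, abs_div, abs_of_pos hn']
  exact div_le_div_of_nonneg_right (hx n) hn'.le

lemma eq_zero_of_mem_X_zero {x : InfWord} (hx : x ∈ X 0) (n : ℕ) : x n = 0 := by
  obtain ⟨δ, h | h⟩ := hx <;> · have := h n; simp at this; exact this

lemma eq_one_of_mem_X_one {x : InfWord} (hx : x ∈ X 1) (n : ℕ) : x n = 1 := by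
  have key : ∀ a : Fin 2, ((a : ℕ) : ℤ) = 1 → a = 1 := by decide
  obtain ⟨δ, h | h⟩ := hx
  · refine key _ ?_
    rw [h, show (1 : ℝ) * (n + 1) + δ = 1 * n + δ + 1 by ring, Int.floor_add_one]; ring
  · refine key _ ?_
    rw [h, show (1 : ℝ) * (n + 1) + δ = 1 * n + δ + 1 by ring, Int.ceil_add_one]; ring

lemma pre_const (a : Fin 2) (n : ℕ) : pre (fun _ => a) n = List.replicate n a := by
  simp [pre]

/-! ### Periodic words -/

/-- The periodic infinite word `u u u …`. -/
def periodic (u : Word) (hu : 0 < u.length) : InfWord :=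
  fun n => u[n % u.length]'(Nat.mod_lt _ hu)

lemma pre_shift_periodic (u : Word) (hu : 0 < u.length) (a : ℕ) :
    pre (shift a (periodic u hu)) u.length = u.rotate a := by
  refine List.ext_getElem (by simp) fun n h1 h2 => ?_
  simp [pre, shift, periodic, List.getElem_rotate, add_comm]

lemma shift_length_periodic (u : Word) (hu : 0 < u.length) :
    shift u.length (periodic u hu) = periodic u hu := by
  funext n; simp [shift, periodic]

lemma shift_mul_length_periodic (u : Word) (hu : 0 < u.length) (n : ℕ) :
    shift (n * u.length) (periodic u hu) = periodic u hu := by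
  funext n; simp [shift, periodic]

lemma pre_periodic_mul (u : Word) (hu : 0 < u.length) (n : ℕ) :
    pre (periodic u hu) (n * u.length) = (List.replicate n u).flatten := by
  induction n with
  | zero => simp [pre]
  | succ n ih =>
    have h := pre_shift_periodic u hu 0
    rw [List.rotate_zero] at h
    rw [Nat.succ_mul, pre_add, ih, shift_mul_length_periodic, List.replicate_succ']
    simp only [List.flatten_append, List.flatten_cons, List.flatten_nil, List.append_nil]
    congr 1
    rw [show periodic u hu = shift 0 (periodic u hu) by funext n; simp [shift], h]

lemma pre_infix (x : InfWord) {a b m L : ℕ} (h1 : a ≤ b) (h2 : b + m ≤ a + L) :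
    pre (shift b x) m <:+: pre (shift a x) L := by
  obtain ⟨k, rfl⟩ := Nat.exists_eq_add_of_le h1
  obtain ⟨l, rfl⟩ := Nat.exists_eq_add_of_le (show k + m ≤ L by omega)
  exact ⟨pre (shift a x) k, pre (shift (a + (k + m)) x) l, by
    rw [pre_add, pre_add, shift_shift, shift_shift]⟩

lemma abs_ones_sub_ones_le_of_window {u : Word} (hu : 0 < u.length) (hc : CyclicallyBalanced u)
    {a b e m : ℕ} (h1 : a ≤ b) (h2 : b + m ≤ a + u.length) (h3 : a ≤ e)
    (h4 : e + m ≤ a + u.length) :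
    |(ones (pre (shift b (periodic u hu)) m) : ℤ) - ones (pre (shift e (periodic u hu)) m)| ≤ 1 :=
  hc (u.rotate a) ⟨a, rfl⟩ _ _ (pre_shift_periodic u hu a ▸ pre_infix _ h1 h2)
    (pre_shift_periodic u hu a ▸ pre_infix _ h3 h4) (by simp)

lemma ones_rotate (u : Word) (a : ℕ) : ones (u.rotate a) = ones u :=
  (List.rotate_perm u a).count_eq 1

lemma ones_pre_shift_periodic_length (u : Word) (hu : 0 < u.length) (a : ℕ) :
    ones (pre (shift a (periodic u hu)) u.length) = ones u := by
  rw [pre_shift_periodic, ones_rotate]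

lemma shift_mod_periodic (u : Word) (hu : 0 < u.length) (a : ℕ) :
    shift (a % u.length) (periodic u hu) = shift a (periodic u hu) := by
  funext n; simp [shift, periodic]

lemma abs_ones_sub_ones_le {u : Word} (hu : 0 < u.length) (hc : CyclicallyBalanced u)
    (i j : ℕ) {m : ℕ} (hm : m ≤ u.length) :
    |(ones (pre (shift i (periodic u hu)) m) : ℤ) - ones (pre (shift j (periodic u hu)) m)| ≤ 1 := by
  rw [← shift_mod_periodic u hu i, ← shift_mod_periodic u hu j]
  have hi := Nat.mod_lt i hu
  have hj := Nat.mod_lt j hu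
  generalize i % u.length = i at *
  generalize j % u.length = j at *
  wlog hij : i ≤ j generalizing i j
  · rw [abs_sub_comm]; exact this j hj i hi (by omega)
  by_cases h1 : j + m ≤ i + u.length
  · exact abs_ones_sub_ones_le_of_window hu hc (a := i) le_rfl (by omega) hij h1
  have hper : shift (i + u.length) (periodic u hu) = shift i (periodic u hu) := by
    rw [add_comm, ← shift_shift, shift_length_periodic]
  by_cases h2 : i + m ≤ j
  · have := abs_ones_sub_ones_le_of_window hu hc (a := j) (b := i + u.length) (e := j) (m := m)
      (by omega) (by omega) le_rfl (by omega)
    rwa [hper] at this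
  · have h3 := abs_ones_sub_ones_le_of_window hu hc (a := i + m) (b := i + m) (e := j + m)
      (m := u.length - m) le_rfl (by omega) (by omega) (by omega)
    have e1 := ones_pre_add (shift i (periodic u hu)) m (u.length - m)
    have e2 := ones_pre_add (shift j (periodic u hu)) m (u.length - m)
    rw [Nat.add_sub_cancel' hm, ones_pre_shift_periodic_length, shift_shift] at e1 e2
    rw [abs_le] at h3 ⊢
    omega

lemma abs_ones_sub_slope_mul_lt {u : Word} (hu : 0 < u.length) (hc : CyclicallyBalanced u)
    (i : ℕ) {m : ℕ} (hm : m ≤ u.length) :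
    |(ones (pre (shift i (periodic u hu)) m) : ℝ) - slope u * m| < 1 := by
  set b : ℕ → ℕ := fun j => ones (pre (shift (i + j * m) (periodic u hu)) m) with hb
  have hsum : ∀ n : ℕ, ∑ j ∈ Finset.range n, b j =
      ones (pre (shift i (periodic u hu)) (n * m)) := by
    intro n
    induction n with
    | zero => simp [pre, ones]
    | succ n ih => rw [Finset.sum_range_succ, ih, Nat.succ_mul, ones_pre_add, shift_shift]
  have hmul : ∀ n : ℕ, ones (pre (shift i (periodic u hu)) (n * u.length)) = n * ones u := by
    intro n
    induction n with
    | zero => simp [pre, ones]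
    | succ n ih => rw [Nat.succ_mul, ones_pre_add, ih, shift_shift,
        ones_pre_shift_periodic_length, Nat.succ_mul]
  have htot : ∑ j ∈ Finset.range u.length, (b j : ℝ) = u.length * (slope u * m) := by
    have := hsum u.length
    rw [mul_comm, hmul] at this
    have h' : ∑ j ∈ Finset.range u.length, (b j : ℝ) = m * ones u := by exact_mod_cast this
    have hu' : (u.length : ℝ) ≠ 0 := by exact_mod_cast hu.ne'
    rw [h', slope]; field_simp
  have hb0 : b 0 = ones (pre (shift i (periodic u hu)) m) := by simp [hb]
  have hdiff : ∀ j, |(b 0 : ℤ) - b j| ≤ 1 := fun j => abs_ones_sub_ones_le hu hc _ _ hm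
  rw [← hb0, abs_lt]
  have hconst : ∑ _j ∈ Finset.range u.length, (slope u * m) = u.length * (slope u * m) := by simp
  have h0 : 0 ∈ Finset.range u.length := by simpa using hu
  constructor
  · by_contra! h
    have : ∑ j ∈ Finset.range u.length, (b j : ℝ) < ∑ _j ∈ Finset.range u.length, (slope u * m) := by
      refine Finset.sum_lt_sum (fun j _ => ?_) ⟨0, h0, by linarith⟩
      have h1 := (abs_le.1 (hdiff j)).1
      have h2 : (b j : ℝ) ≤ b 0 + 1 := by exact_mod_cast (by omega : (b j : ℤ) ≤ b 0 + 1)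
      linarith
    linarith
  · by_contra! h
    have : ∑ _j ∈ Finset.range u.length, (slope u * m) < ∑ j ∈ Finset.range u.length, (b j : ℝ) := by
      refine Finset.sum_lt_sum (fun j _ => ?_) ⟨0, h0, by linarith⟩
      have h1 := (abs_le.1 (hdiff j)).2
      have h2 : (b 0 : ℝ) ≤ b j + 1 := by exact_mod_cast (by omega : (b 0 : ℤ) ≤ b j + 1)
      linarith
    linarith

lemma periodic_mem_X {u : Word} (hu : 0 < u.length) (hc : CyclicallyBalanced u) :
    periodic u hu ∈ X (slope u) := by
  set x := periodic u hu
  set c : ℕ → ℕ := fun n => ones (pre x n) with hcdef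
  set d : ℕ → ℝ := fun n => c n - slope u * n with hd
  have hu' : (u.length : ℝ) ≠ 0 := by exact_mod_cast hu.ne'
  have hper : ∀ n, d (n + u.length) = d n := by
    intro n
    simp only [hd, hcdef]
    rw [ones_pre_add, ones_pre_shift_periodic_length, slope]
    push_cast
    field_simp
    ring
  have hmod : ∀ n, d (n % u.length) = d n := fun n => Function.Periodic.map_mod_nat hper n
  have hlt : ∀ i j, d i - d j < 1 := by
    intro i j
    rw [← hmod i, ← hmod j]
    have hi := Nat.mod_lt i hu
    have hj := Nat.mod_lt j hu
    generalize i % u.length = i at *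
    generalize j % u.length = j at *
    rcases le_total i j with h | h
    · obtain ⟨m, rfl⟩ := Nat.exists_eq_add_of_le h
      have := (abs_lt.1 (abs_ones_sub_slope_mul_lt hu hc i (m := m) (by omega))).1
      simp only [hd, hcdef, ones_pre_add]
      push_cast
      linarith
    · obtain ⟨m, rfl⟩ := Nat.exists_eq_add_of_le h
      have := (abs_lt.1 (abs_ones_sub_slope_mul_lt hu hc j (m := m) (by omega))).2
      simp only [hd, hcdef, ones_pre_add]
      push_cast
      linarith
  obtain ⟨k, -, hk⟩ := Finset.exists_max_image (Finset.range u.length) d ⟨0, by simpa using hu⟩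
  have hmax : ∀ n, d n ≤ d k := fun n => by
    rw [← hmod n]; exact hk _ (by simpa using Nat.mod_lt n hu)
  have hfloor : ∀ n : ℕ, ⌊slope u * (n : ℝ) + d k⌋ = (c n : ℤ) := by
    intro n
    rw [Int.floor_eq_iff]
    have h1 := hmax n
    have h2 := hlt k n
    have h3 : d n = c n - slope u * n := rfl
    push_cast
    constructor <;> linarith
  refine ⟨d k, Or.inl fun n => ?_⟩
  have h1 := hfloor (n + 1)
  push_cast at h1
  have h2 : c (n + 1) = c n + (x n : ℕ) := ones_pre_succ x n
  rw [h1, hfloor, h2]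
  push_cast; ring

end SturmianPair
namespace SturmianPair

/-! ### Pressure of a subadditive potential on words -/

/-- The potential `G` tilted by `s` times the number of ones. -/
noncomputable def tilt (G : Word → ℝ) (s : ℝ) (u : Word) : ℝ := G u + s * ones u

/-- The maximum of the tilted potential over the words of length `n`. -/
noncomputable def tiltMax (G : Word → ℝ) (s : ℝ) (n : ℕ) : ℝ :=
  (Finset.univ : Finset (Fin n → Fin 2)).sup' Finset.univ_nonempty
    fun w => tilt G s (List.ofFn w)

/-- The exponential growth rate of the maximum of the tilted potential. -/
noncomputable def pressure (G : Word → ℝ) (s : ℝ) : ℝ :=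
  limUnder atTop fun n : ℕ => tiltMax G s n / n

/-- A subadditive potential with finite growth rates along the constant words. -/
structure SubadditivePotential (G : Word → ℝ) (l : Fin 2 → ℝ) : Prop where
  append_le : ∀ u v, G (u ++ v) ≤ G u + G v
  tendsto_const : ∀ a, Tendsto (fun n : ℕ => G (List.replicate n a) / n) atTop (𝓝 (l a))

lemma tilt_le_tiltMax (G : Word → ℝ) (s : ℝ) (u : Word) : tilt G s u ≤ tiltMax G s u.length := by
  have := Finset.le_sup' (s := (Finset.univ : Finset (Fin u.length → Fin 2)))
    (fun w => tilt G s (List.ofFn w)) (Finset.mem_univ u.get)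
  simpa only [tiltMax, List.ofFn_get] using this

lemma tiltMax_le {G : Word → ℝ} {s c : ℝ} {n : ℕ}
    (h : ∀ u : Word, u.length = n → tilt G s u ≤ c) : tiltMax G s n ≤ c :=
  Finset.sup'_le _ _ fun w _ => h _ (by simp)

namespace SubadditivePotential

variable {G : Word → ℝ} {l : Fin 2 → ℝ}

lemma tilt_append_le (h : SubadditivePotential G l) (s : ℝ) (u v : Word) :
    tilt G s (u ++ v) ≤ tilt G s u + tilt G s v := by
  have := h.append_le u v
  simp only [tilt, ones_append]
  push_cast
  linarith

lemma subadditive_tiltMax (h : SubadditivePotential G l) (s : ℝ) : Subadditive (tiltMax G s) := by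
  intro m n
  refine tiltMax_le fun u hu => ?_
  rw [← List.take_append_drop m u]
  refine (h.tilt_append_le s _ _).trans (add_le_add ?_ ?_)
  · exact (tilt_le_tiltMax G s _).trans_eq (by simp [hu])
  · exact (tilt_le_tiltMax G s _).trans_eq (by simp [hu])

lemma bddBelow_tiltMax (h : SubadditivePotential G l) (s : ℝ) :
    BddBelow (Set.range fun n : ℕ => tiltMax G s n / n) := by
  obtain ⟨c, hc⟩ := (h.tendsto_const 0).bddBelow_range
  refine ⟨c, ?_⟩
  rintro _ ⟨n, rfl⟩
  refine (hc ⟨n, rfl⟩).trans (div_le_div_of_nonneg_right ?_ n.cast_nonneg)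
  have := tilt_le_tiltMax G s (List.replicate n 0)
  simpa [tilt, ones, List.count_replicate] using this

lemma tendsto_pressure (h : SubadditivePotential G l) (s : ℝ) :
    Tendsto (fun n : ℕ => tiltMax G s n / n) atTop (𝓝 (pressure G s)) :=
  tendsto_nhds_limUnder ⟨_, (h.subadditive_tiltMax s).tendsto_lim (h.bddBelow_tiltMax s)⟩

lemma pressure_le_div (h : SubadditivePotential G l) (s : ℝ) {n : ℕ} (hn : n ≠ 0) :
    pressure G s ≤ tiltMax G s n / n := by
  rw [tendsto_nhds_unique (h.tendsto_pressure s)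
    ((h.subadditive_tiltMax s).tendsto_lim (h.bddBelow_tiltMax s))]
  exact (h.subadditive_tiltMax s).lim_le_div (h.bddBelow_tiltMax s) hn

/-- Growth rates along powers of a word are bounded by the pressure. -/
lemma power_rate_le (h : SubadditivePotential G l) (s : ℝ) {u : Word} {c : ℝ}
    (hu : 0 < u.length)
    (hc : Tendsto (fun n : ℕ => G (List.replicate n u).flatten / n) atTop (𝓝 c)) :
    c + s * ones u ≤ u.length * pressure G s := by
  have hlen : ∀ n : ℕ, (List.replicate n u).flatten.length = n * u.length := fun n => by simp
  have hones : ∀ n : ℕ, ones (List.replicate n u).flatten = n * ones u := fun n => by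
    simp [ones, List.count_flatten]
  have h1 : Tendsto (fun n : ℕ => (u.length : ℝ) *
      (tiltMax G s (n * u.length) / ((n * u.length : ℕ) : ℝ))) atTop
      (𝓝 (u.length * pressure G s)) :=
    ((h.tendsto_pressure s).comp (tendsto_id.atTop_mul_const' hu)).const_mul _
  refine le_of_tendsto_of_tendsto (hc.add_const _) h1 ?_
  filter_upwards [eventually_gt_atTop 0] with n hn
  have hn' : (0 : ℝ) < n := by exact_mod_cast hn
  have hu' : (0 : ℝ) < u.length := by exact_mod_cast hu
  have := tilt_le_tiltMax G s (List.replicate n u).flatten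
  rw [hlen, tilt, hones] at this
  push_cast at this ⊢
  have e : (u.length : ℝ) * (tiltMax G s (n * u.length) / (n * u.length)) =
    tiltMax G s (n * u.length) / n := by field_simp
  rw [e, le_div_iff₀ hn', add_mul, div_mul_cancel₀ _ hn'.ne']
  linarith

lemma const_rate_le (h : SubadditivePotential G l) (s : ℝ) (a : Fin 2) :
    l a + s * ((a : ℕ) : ℝ) ≤ pressure G s := by
  have hc := h.tendsto_const a
  have := h.power_rate_le s (u := [a]) (c := l a) (by simp) (by simpa using hc)
  have h2 : ∀ b : Fin 2, ones [b] = (b : ℕ) := by decide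
  rw [h2] at this
  simpa using this

/-- As the weight of the letter `1` vanishes, the pressure approaches the growth rate along
`000…`. -/
lemma exists_pressure_lt_zero (h : SubadditivePotential G l) {ε : ℝ} (hε : 0 < ε) :
    ∃ s, pressure G s < l 0 + ε := by
  obtain ⟨n, hn, hn0⟩ := (((h.tendsto_const 0).eventually_lt_const
    (show l 0 < l 0 + ε / 2 by linarith)).and (eventually_gt_atTop 0)).exists
  have hn' : (0 : ℝ) < n := by exact_mod_cast hn0
  have hev : ∀ᶠ s in atBot, ∀ w : Fin n → Fin 2,
      tilt G s (List.ofFn w) ≤ n * (l 0 + ε / 2) := by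
    refine eventually_all.2 fun w => ?_
    rcases Nat.eq_zero_or_pos (ones (List.ofFn w)) with h0 | h0
    · refine Eventually.of_forall fun s => ?_
      have := eq_replicate_zero h0
      rw [List.length_ofFn] at this
      rw [tilt, h0, this]
      rw [div_lt_iff₀ hn'] at hn
      simp only [Nat.cast_zero, mul_zero, add_zero]
      linarith
    · have h0' : (0 : ℝ) < ones (List.ofFn w) := by exact_mod_cast h0
      exact ((tendsto_atBot_add_const_left _ (G (List.ofFn w))
        (tendsto_id.atBot_mul_const h0')).eventually_le_atBot _)
  obtain ⟨s, hs⟩ := hev.exists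
  refine ⟨s, (h.pressure_le_div s hn0.ne').trans_lt ?_⟩
  have : tiltMax G s n ≤ n * (l 0 + ε / 2) := Finset.sup'_le _ _ fun w _ => hs w
  rw [div_lt_iff₀ hn']
  nlinarith

/-- As the weight of the letter `1` grows, the renormalised pressure approaches the growth rate
along `111…`. -/
lemma exists_pressure_lt_one (h : SubadditivePotential G l) {ε : ℝ} (hε : 0 < ε) :
    ∃ s, pressure G s < l 1 + s + ε := by
  obtain ⟨n, hn, hn0⟩ := (((h.tendsto_const 1).eventually_lt_const
    (show l 1 < l 1 + ε / 2 by linarith)).and (eventually_gt_atTop 0)).exists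
  have hn' : (0 : ℝ) < n := by exact_mod_cast hn0
  have hev : ∀ᶠ s : ℝ in atTop, ∀ w : Fin n → Fin 2,
      tilt G s (List.ofFn w) ≤ n * (l 1 + ε / 2 + s) := by
    refine eventually_all.2 fun w => ?_
    have hle := ones_le_length (List.ofFn w)
    rw [List.length_ofFn] at hle
    rcases hle.eq_or_lt with h0 | h0
    · refine Eventually.of_forall fun s => ?_
      have := eq_replicate_one (u := List.ofFn w) (by simpa using h0)
      rw [List.length_ofFn] at this
      rw [tilt, h0, this]
      rw [div_lt_iff₀ hn'] at hn
      linarith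
    · have h0' : (0 : ℝ) < n - ones (List.ofFn w) := by
        have : (ones (List.ofFn w) : ℝ) < n := by exact_mod_cast h0
        linarith
      filter_upwards [(tendsto_id.atTop_mul_const h0').eventually_ge_atTop
        (G (List.ofFn w) - n * (l 1 + ε / 2))] with s hs
      simp only [id, tilt] at hs ⊢
      linarith
  obtain ⟨s, hs⟩ := hev.exists
  refine ⟨s, (h.pressure_le_div s hn0.ne').trans_lt ?_⟩
  have : tiltMax G s n ≤ n * (l 1 + ε / 2 + s) := Finset.sup'_le _ _ fun w _ => hs w
  rw [div_lt_iff₀ hn']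
  nlinarith

end SubadditivePotential

/-- The word `x` attains the pressure of `G` at `s`. -/
def Attains (G : Word → ℝ) (s : ℝ) (x : InfWord) : Prop :=
  Tendsto (fun n : ℕ => tilt G s (pre x n) / n) atTop (𝓝 (pressure G s))

/-- A subadditive potential whose pressure at `s` is attained by the rotation words of slope
`R s`, and only by words with this proportion of ones. -/
structure SturmianPotential (G : Word → ℝ) (l : Fin 2 → ℝ) (R : ℝ → ℝ) : Prop
    extends SubadditivePotential G l where
  mem_Icc : ∀ s, R s ∈ Set.Icc (0 : ℝ) 1
  attains : ∀ s, ∀ x ∈ X (R s), Attains G s x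
  ratio : ∀ s x, Attains G s x → Tendsto (fun n : ℕ => (ones (pre x n) : ℝ) / n) atTop (𝓝 (R s))

namespace SturmianPotential

variable {G : Word → ℝ} {l : Fin 2 → ℝ} {R : ℝ → ℝ}

lemma tendsto_potential (h : SturmianPotential G l R) (s : ℝ) {x : InfWord} (hx : x ∈ X (R s)) :
    Tendsto (fun n : ℕ => G (pre x n) / n) atTop (𝓝 (pressure G s - s * R s)) := by
  refine ((h.attains s x hx).sub
    ((tendsto_ratio (abs_ones_sub_le hx)).const_mul s)).congr fun n => ?_
  rw [tilt]; ring

lemma tangent_le (h : SturmianPotential G l R) (s t : ℝ) :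
    pressure G s + (t - s) * R s ≤ pressure G t := by
  obtain ⟨x, hx⟩ := X_nonempty (h.mem_Icc s)
  have h1 := (h.tendsto_potential s hx).add
    ((tendsto_ratio (abs_ones_sub_le hx)).const_mul t)
  rw [show pressure G s - s * R s + t * R s = pressure G s + (t - s) * R s by ring] at h1
  refine le_of_tendsto_of_tendsto' h1 (h.tendsto_pressure t) fun n => ?_
  have := tilt_le_tiltMax G t (pre x n)
  rw [length_pre] at this
  refine le_trans (le_of_eq ?_) (div_le_div_of_nonneg_right this n.cast_nonneg)
  rw [tilt]; ring

lemma continuous_pressure (h : SturmianPotential G l R) : Continuous (pressure G) := by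
  refine (LipschitzWith.of_le_add fun s t => ?_ : LipschitzWith 1 (pressure G)).continuous
  have h1 := h.tangent_le s t
  have h2 := h.mem_Icc s
  have h3 : (s - t) * R s ≤ dist s t := by
    rw [Real.dist_eq]
    calc (s - t) * R s ≤ |s - t| * R s := mul_le_mul_of_nonneg_right (le_abs_self _) h2.1
      _ ≤ |s - t| := mul_le_of_le_one_right (abs_nonneg _) h2.2
  linarith

lemma exists_mem_X_forall_le (h : SturmianPotential G l R) (s : ℝ) {ε : ℝ} (hε : 0 < ε) :
    ∃ y ∈ X (R s), ∀ m : ℕ, m * (pressure G s - ε) ≤ tilt G s (pre y m) := by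
  obtain ⟨x, hx⟩ := X_nonempty (h.mem_Icc s)
  set L : ℕ → ℝ := fun m => tilt G s (pre x m) - m * (pressure G s - ε) with hL
  have hlim : Tendsto L atTop atTop := by
    have h1 : Tendsto (fun n : ℕ => tilt G s (pre x n) / n - (pressure G s - ε)) atTop
        (𝓝 ε) := by
      simpa using (h.attains s x hx).sub_const (pressure G s - ε)
    refine (h1.pos_mul_atTop hε tendsto_natCast_atTop_atTop).congr' ?_
    filter_upwards [eventually_gt_atTop 0] with n hn
    have hn' : (n : ℝ) ≠ 0 := by exact_mod_cast hn.ne'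
    simp only [hL]
    field_simp
  obtain ⟨k, hk⟩ := Filter.Tendsto.exists_forall_le (by rwa [Nat.cofinite_eq_atTop]) (f := L)
  refine ⟨shift k x, shift_mem_X hx k, fun m => ?_⟩
  have h1 := hk (k + m)
  have h2 := h.tilt_append_le s (pre x k) (pre (shift k x) m)
  rw [← pre_add] at h2
  simp only [hL] at h1
  push_cast at h1
  linarith

lemma eq_of_tendsto (h : SturmianPotential G l R) {σ : ℕ → ℝ} {s a : ℝ}
    (hσ : Tendsto σ atTop (𝓝 s)) (ha : Tendsto (fun n => R (σ n)) atTop (𝓝 a)) : a = R s := by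
  choose y hyX hy using fun n : ℕ =>
    h.exists_mem_X_forall_le (σ n) (Nat.one_div_pos_of_nat (α := ℝ) (n := n))
  obtain ⟨z, -, φ, hφ, hz⟩ := isCompact_univ.isSeqCompact (x := y) (fun _ => Set.mem_univ _)
  have hφ' := hφ.tendsto_atTop
  have hpre : ∀ m : ℕ, ∀ᶠ n in atTop, pre (y (φ n)) m = pre z m := by
    intro m
    have h1 : ∀ᶠ n in atTop, ∀ i : Fin m, y (φ n) i = z i := by
      refine eventually_all.2 fun i => ?_
      have := (tendsto_pi_nhds.1 hz) (i : ℕ)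
      rw [nhds_discrete, tendsto_pure] at this
      exact this
    filter_upwards [h1] with n hn
    simp only [pre]
    congr 1
    funext i
    exact hn i
  have hones : ∀ m : ℕ, |(ones (pre z m) : ℝ) - a * m| ≤ 1 := by
    intro m
    have h1 : Tendsto (fun n => |(ones (pre z m) : ℝ) - R (σ (φ n)) * m|) atTop
        (𝓝 |(ones (pre z m) : ℝ) - a * m|) :=
      (((ha.comp hφ').mul_const _).const_sub _).abs
    refine le_of_tendsto h1 ?_
    filter_upwards [hpre m] with n hn
    rw [← hn]
    exact abs_ones_sub_le (hyX _) m
  have htilt : ∀ m : ℕ, m * pressure G s ≤ tilt G s (pre z m) := by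
    intro m
    have h1 : Tendsto (fun n => (m : ℝ) * (pressure G (σ (φ n)) - 1 / ((φ n : ℕ) + 1 : ℝ))) atTop
        (𝓝 (m * (pressure G s - 0))) :=
      ((((h.continuous_pressure.tendsto s).comp (hσ.comp hφ')).sub
        (tendsto_one_div_add_atTop_nhds_zero_nat.comp hφ')).const_mul _)
    have h2 : Tendsto (fun n => tilt G (σ (φ n)) (pre z m)) atTop (𝓝 (tilt G s (pre z m))) :=
      ((hσ.comp hφ').mul_const _).const_add _
    rw [sub_zero] at h1
    refine le_of_tendsto_of_tendsto h1 h2 ?_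
    filter_upwards [hpre m] with n hn
    rw [← hn]
    exact hy _ m
  refine tendsto_nhds_unique (tendsto_ratio hones) (h.ratio s z ?_)
  refine tendsto_of_tendsto_of_tendsto_of_le_of_le' tendsto_const_nhds (h.tendsto_pressure s) ?_ ?_
  · filter_upwards [eventually_gt_atTop 0] with n hn
    have hn' : (0 : ℝ) < n := by exact_mod_cast hn
    rw [le_div_iff₀ hn', mul_comm]
    exact htilt n
  · refine Eventually.of_forall fun n => div_le_div_of_nonneg_right ?_ n.cast_nonneg
    simpa using tilt_le_tiltMax G s (pre z n)

/-- The pressure has `R s` as its only subgradient at `s`. -/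
lemma eq_of_subgradient (h : SturmianPotential G l R) {s γ : ℝ}
    (hγ : ∀ t, pressure G s + (t - s) * γ ≤ pressure G t) : γ = R s := by
  have hmono : ∀ t, 0 ≤ (t - s) * (R t - γ) := fun t => by
    have h1 := hγ t
    have h2 := h.tangent_le t s
    nlinarith
  have key : ∀ σ : ℕ → ℝ, Tendsto σ atTop (𝓝 s) → ∃ φ : ℕ → ℕ,
      Tendsto (fun n => R (σ (φ n))) atTop (𝓝 (R s)) := by
    intro σ hσ
    obtain ⟨a, -, φ, hφ, hz⟩ := isCompact_Icc.isSeqCompact (x := fun n => R (σ n))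
      (fun n => h.mem_Icc (σ n))
    refine ⟨φ, ?_⟩
    rwa [← h.eq_of_tendsto (hσ.comp hφ.tendsto_atTop) hz]
  have hlim := tendsto_one_div_add_atTop_nhds_zero_nat (𝕜 := ℝ)
  have hpos : ∀ n : ℕ, (0 : ℝ) < 1 / ((n : ℝ) + 1) := fun n => Nat.one_div_pos_of_nat
  refine le_antisymm ?_ ?_
  · obtain ⟨φ, hφ⟩ := key (fun n => s + 1 / ((n : ℝ) + 1)) (by simpa using hlim.const_add s)
    refine ge_of_tendsto' hφ fun n => ?_
    have h1 := hmono (s + 1 / ((φ n : ℝ) + 1))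
    rw [add_sub_cancel_left] at h1
    linarith [nonneg_of_mul_nonneg_right h1 (hpos _)]
  · obtain ⟨φ, hφ⟩ := key (fun n => s - 1 / ((n : ℝ) + 1)) (by simpa using hlim.const_sub s)
    refine le_of_tendsto' hφ fun n => ?_
    have h1 := hmono (s - 1 / ((φ n : ℝ) + 1))
    rw [show s - 1 / ((φ n : ℝ) + 1) - s = -(1 / ((φ n : ℝ) + 1)) by ring, neg_mul,
      ← mul_neg] at h1
    linarith [nonneg_of_mul_nonneg_right h1 (hpos _)]

end SturmianPotential

/-! ### The entropy-like function dual to the pressure -/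

/-- The concave dual of the pressure. -/
noncomputable def dual (G : Word → ℝ) (γ : ℝ) : ℝ := ⨅ s : ℝ, (pressure G s - s * γ)

namespace SubadditivePotential

variable {G : Word → ℝ} {l : Fin 2 → ℝ}

lemma le_pressure_sub (h : SubadditivePotential G l) {γ : ℝ} (hγ : γ ∈ Set.Icc (0 : ℝ) 1) (s : ℝ) :
    (1 - γ) * l 0 + γ * l 1 ≤ pressure G s - s * γ := by
  have h0 := h.const_rate_le s 0
  have h1 := h.const_rate_le s 1
  simp only [Fin.val_zero, Fin.val_one, Nat.cast_zero, Nat.cast_one, mul_zero, add_zero,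
    mul_one] at h0 h1
  nlinarith [hγ.1, hγ.2, mul_le_mul_of_nonneg_left h0 (sub_nonneg.2 hγ.2),
    mul_le_mul_of_nonneg_left h1 hγ.1]

lemma dual_le (h : SubadditivePotential G l) {γ : ℝ} (hγ : γ ∈ Set.Icc (0 : ℝ) 1) (s : ℝ) :
    dual G γ ≤ pressure G s - s * γ :=
  ciInf_le ⟨_, by rintro _ ⟨s, rfl⟩; exact h.le_pressure_sub hγ s⟩ s

lemma le_dual {c γ : ℝ} (hc : ∀ s, c ≤ pressure G s - s * γ) : c ≤ dual G γ := le_ciInf hc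

lemma dual_zero (h : SubadditivePotential G l) : dual G 0 = l 0 := by
  refine le_antisymm (le_of_forall_pos_le_add fun ε hε => ?_) (le_dual fun s => ?_)
  · obtain ⟨s, hs⟩ := h.exists_pressure_lt_zero hε
    have := h.dual_le (γ := 0) (by simp) s
    linarith
  · have := h.le_pressure_sub (γ := 0) (by simp) s
    linarith

lemma dual_one (h : SubadditivePotential G l) : dual G 1 = l 1 := by
  refine le_antisymm (le_of_forall_pos_le_add fun ε hε => ?_) (le_dual fun s => ?_)
  · obtain ⟨s, hs⟩ := h.exists_pressure_lt_one hε
    have := h.dual_le (γ := 1) (by simp) s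
    linarith
  · have := h.le_pressure_sub (γ := 1) (by simp) s
    linarith

lemma concaveOn_dual (h : SubadditivePotential G l) : ConcaveOn ℝ (Set.Icc 0 1) (dual G) := by
  refine ⟨convex_Icc 0 1, fun γ hγ η hη a b ha hb hab => le_dual fun s => ?_⟩
  have h1 := mul_le_mul_of_nonneg_left (h.dual_le hγ s) ha
  have h2 := mul_le_mul_of_nonneg_left (h.dual_le hη s) hb
  simp only [smul_eq_mul]
  have : pressure G s - s * (a * γ + b * η) =
      a * (pressure G s - s * γ) + b * (pressure G s - s * η) := by
    linear_combination (-pressure G s) * hab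
  linarith

lemma eventually_dual_lt (h : SubadditivePotential G l) {γ c : ℝ} (hc : dual G γ < c) :
    ∀ᶠ η in 𝓝[Set.Icc 0 1] γ, dual G η < c := by
  obtain ⟨s, hs⟩ := exists_lt_of_ciInf_lt hc
  have hcont : Tendsto (fun η => pressure G s - s * η) (𝓝[Set.Icc 0 1] γ)
      (𝓝 (pressure G s - s * γ)) :=
    (Continuous.tendsto (by fun_prop) γ).mono_left nhdsWithin_le_nhds
  filter_upwards [hcont.eventually_lt_const hs, self_mem_nhdsWithin] with η h1 h2
  exact (h.dual_le h2 s).trans_lt h1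

lemma continuousOn_dual (h : SubadditivePotential G l) :
    ContinuousOn (dual G) (Set.Icc 0 1) := by
  intro γ hγ
  refine tendsto_order.2 ⟨fun c hc => ?_, fun c hc => h.eventually_dual_lt hc⟩
  have key : ∀ e ∈ Set.Icc (0 : ℝ) 1, ∀ᶠ η in 𝓝 γ, ∀ t, 0 ≤ t → t ≤ 1 →
      (e - γ) * t = η - γ → e ≠ γ → c < dual G η := by
    intro e he
    rcases eq_or_ne e γ with rfl | hne
    · exact Eventually.of_forall fun η t _ _ _ hne => absurd rfl hne
    have hne' : e - γ ≠ 0 := sub_ne_zero.2 hne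
    have hcont : Tendsto (fun η => (1 - (η - γ) / (e - γ)) * dual G γ +
        (η - γ) / (e - γ) * dual G e) (𝓝 γ)
        (𝓝 ((1 - (γ - γ) / (e - γ)) * dual G γ + (γ - γ) / (e - γ) * dual G e)) :=
      Continuous.tendsto (by fun_prop) γ
    simp only [sub_self, zero_div, sub_zero, one_mul, zero_mul, add_zero] at hcont
    filter_upwards [hcont.eventually_const_lt hc] with η hη t ht0 ht1 ht _
    have ht' : (η - γ) / (e - γ) = t := by rw [← ht]; field_simp
    rw [ht'] at hη
    have h1 := h.concaveOn_dual.2 hγ he (sub_nonneg.2 ht1) ht0 (by ring)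
    simp only [smul_eq_mul] at h1
    rw [show (1 - t) * γ + t * e = η by linear_combination ht] at h1
    linarith
  filter_upwards [nhdsWithin_le_nhds (key 0 (by simp)), nhdsWithin_le_nhds (key 1 (by simp)),
    self_mem_nhdsWithin] with η h0 h1 hη
  rcases lt_trichotomy η γ with hlt | rfl | hlt
  · have hγ0 : 0 < γ := hη.1.trans_lt hlt
    refine h0 ((γ - η) / γ) (div_nonneg (by linarith) hγ0.le)
      ((div_le_one hγ0).2 (by linarith [hη.1])) (by field_simp; ring) hγ0.ne
  · exact hc
  · have hγ1 : 0 < 1 - γ := by linarith [hη.2]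
    refine h1 ((η - γ) / (1 - γ)) (div_nonneg (by linarith) hγ1.le)
      ((div_le_one hγ1).2 (by linarith [hη.2])) (by field_simp) (by linarith)

end SubadditivePotential

namespace SturmianPotential

variable {G : Word → ℝ} {l : Fin 2 → ℝ} {R : ℝ → ℝ}

lemma dual_eq_iff (h : SturmianPotential G l R) {γ : ℝ} (hγ : γ ∈ Set.Icc (0 : ℝ) 1) (s : ℝ) :
    dual G γ = pressure G s - s * γ ↔ γ = R s := by
  constructor
  · intro heq
    refine h.eq_of_subgradient fun t => ?_
    have := h.dual_le hγ t
    linarith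
  · rintro rfl
    refine le_antisymm (h.dual_le hγ s) (SubadditivePotential.le_dual fun t => ?_)
    have := h.tangent_le s t
    linarith

lemma exists_eq (h : SturmianPotential G l R) {γ : ℝ} (hγ : γ ∈ Set.Ioo (0 : ℝ) 1) :
    ∃ s, γ = R s := by
  have hcont : Continuous fun s => pressure G s - s * γ :=
    h.continuous_pressure.sub (by fun_prop)
  have hbot : Tendsto (fun s => pressure G s - s * γ) atBot atTop := by
    refine tendsto_atTop_mono (fun s => ?_) (tendsto_atTop_add_const_left atBot (l 0)
      ((tendsto_neg_atBot_atTop (G := ℝ)).atTop_mul_const hγ.1))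
    have := h.const_rate_le s 0
    simp at this
    linarith
  have htop : Tendsto (fun s => pressure G s - s * γ) atTop atTop := by
    refine tendsto_atTop_mono (fun s => ?_) (tendsto_atTop_add_const_left atTop (l 1)
      ((tendsto_id (α := ℝ)).atTop_mul_const (sub_pos.2 hγ.2)))
    have := h.const_rate_le s 1
    simp at this
    simp only [id]
    linarith
  obtain ⟨s, hs⟩ := hcont.exists_forall_le (by
    rw [cocompact_eq_atBot_atTop]; exact hbot.sup htop)
  refine ⟨s, h.eq_of_subgradient fun t => ?_⟩
  have := hs t
  linarith

lemma tendsto_dual (h : SturmianPotential G l R) {γ : ℝ} (hγ : γ ∈ Set.Icc (0 : ℝ) 1)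
    {x : InfWord} (hx : x ∈ X γ) :
    Tendsto (fun n : ℕ => G (pre x n) / n) atTop (𝓝 (dual G γ)) := by
  rcases hγ.1.eq_or_lt with rfl | h0
  · rw [h.dual_zero, show x = fun _ => 0 from funext (eq_zero_of_mem_X_zero hx)]
    simpa [pre_const] using h.tendsto_const 0
  rcases hγ.2.eq_or_lt with rfl | h1
  · rw [h.dual_one, show x = fun _ => 1 from funext (eq_one_of_mem_X_one hx)]
    simpa [pre_const] using h.tendsto_const 1
  obtain ⟨s, rfl⟩ := h.exists_eq ⟨h0, h1⟩
  rw [(h.dual_eq_iff hγ s).2 rfl]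
  exact h.tendsto_potential s hx

lemma isSubgradient_iff (h : SturmianPotential G l R) {γ : ℝ} (hγ : γ ∈ Set.Icc (0 : ℝ) 1)
    (s : ℝ) : R s = γ ↔ IsSubgradient (dual G) γ (-s) := by
  constructor
  · rintro rfl t ht
    have h1 := h.dual_le ht s
    have h2 := (h.dual_eq_iff hγ s).2 rfl
    linarith
  · intro hsub
    have h1 := hsub (R s) (h.mem_Icc s)
    have h2 := (h.dual_eq_iff (h.mem_Icc s) s).2 rfl
    have h3 := h.dual_le hγ s
    exact ((h.dual_eq_iff hγ s).1 (by linarith)).symm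

end SturmianPotential

end SturmianPair
namespace SturmianPair

/-! ### Logarithmic norms of matrices -/

section Norm

attribute [local instance] Matrix.linftyOpNormedRing Matrix.linftyOpNormedAlgebra

/-- The logarithm of the row-sum norm. -/
noncomputable def logNorm (M : Mat2) : ℝ := Real.log ‖M‖

lemma logNorm_mul_le {M P : Mat2} (hM : IsUnit M) (hP : IsUnit P) :
    logNorm (M * P) ≤ logNorm M + logNorm P := by
  rw [logNorm, logNorm, logNorm,
    ← Real.log_mul (norm_ne_zero_iff.2 hM.ne_zero) (norm_ne_zero_iff.2 hP.ne_zero)]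
  exact Real.log_le_log (norm_pos_iff.2 (hM.mul hP).ne_zero) (norm_mul_le _ _)

lemma logNorm_smul {c : ℝ} (hc : 0 < c) {M : Mat2} (hM : M ≠ 0) :
    logNorm (c • M) = Real.log c + logNorm M := by
  rw [logNorm, logNorm, norm_smul, Real.norm_of_nonneg hc.le,
    Real.log_mul hc.ne' (norm_ne_zero_iff.2 hM)]

lemma exists_abs_log_sub_logNorm_le (N : Seminorm ℝ Mat2) (hN : ∀ M : Mat2, N M = 0 → M = 0) :
    ∃ C, ∀ M : Mat2, M ≠ 0 → |Real.log (N M) - logNorm M| ≤ C := by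
  have hcont : Continuous N :=
    continuousOn_univ.1 (ConvexOn.continuousOn isOpen_univ N.convexOn)
  have : ProperSpace Mat2 := FiniteDimensional.proper ℝ Mat2
  obtain ⟨C, hC⟩ := (isCompact_sphere (0 : Mat2) 1).exists_bound_of_continuousOn
    (f := fun M => Real.log (N M)) (hcont.continuousOn.log fun M hM h0 => by
      rw [hN M h0] at hM; simp at hM)
  refine ⟨C, fun M hM => ?_⟩
  have hM' : ‖M‖ ≠ 0 := norm_ne_zero_iff.2 hM
  have hNM : N M ≠ 0 := fun h => hM (hN M h)
  have h1 := hC (‖M‖⁻¹ • M) (by simp [norm_smul, hM'])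
  rwa [map_smul_eq_mul, norm_inv, norm_norm, Real.log_mul (inv_ne_zero hM') hNM, Real.log_inv,
    Real.norm_eq_abs, neg_add_eq_sub] at h1

lemma norm_map_ofReal (M : Mat2) : ‖M.map (fun t : ℝ => (t : ℂ))‖ = ‖M‖ := by
  simp [Matrix.linfty_opNorm_def]

lemma specRad_ne_top_and_pos {M : Mat2} (hM : IsUnit M) :
    spectralRadius ℂ (M.map (fun t : ℝ => (t : ℂ))) ≠ ⊤ ∧ 0 < specRad M := by
  obtain ⟨z, hz, h⟩ := spectrum.exists_nnnorm_eq_spectralRadius (M.map (fun t : ℝ => (t : ℂ)))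
  have hu : IsUnit (M.map (fun t : ℝ => (t : ℂ))) := hM.map (Complex.ofRealHom.mapMatrix)
  have hz0 : z ≠ 0 := by
    rintro rfl
    exact spectrum.zero_notMem ℂ hu hz
  rw [specRad, ← h]
  simp [hz0]

lemma specRad_pos {M : Mat2} (hM : IsUnit M) : 0 < specRad M := (specRad_ne_top_and_pos hM).2

/-- Gelfand's formula. -/
lemma tendsto_logNorm_pow {M : Mat2} (hM : IsUnit M) :
    Tendsto (fun n : ℕ => logNorm (M ^ n) / n) atTop (𝓝 (Real.log (specRad M))) := by
  have h1 := spectrum.pow_norm_pow_one_div_tendsto_nhds_spectralRadius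
    (M.map (fun t : ℝ => (t : ℂ)))
  have hpow : ∀ n : ℕ, ‖M.map (fun t : ℝ => (t : ℂ)) ^ n‖ = ‖M ^ n‖ := fun n => by
    rw [← norm_map_ofReal (M ^ n)]
    exact congrArg _ (map_pow Complex.ofRealHom.mapMatrix M n).symm
  simp only [hpow] at h1
  have h2 := ((ENNReal.tendsto_toReal (specRad_ne_top_and_pos hM).1).comp h1).log
    (specRad_pos hM).ne'
  refine h2.congr fun n => ?_
  have hpos : 0 < ‖M ^ n‖ := norm_pos_iff.2 (hM.pow n).ne_zero
  rw [Function.comp_apply, ENNReal.toReal_ofReal (by positivity), Real.log_rpow hpos, logNorm]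
  ring

end Norm

/-! ### Products along words -/

lemma wordProd_append (B : Fin 2 → Mat2) (u v : Word) :
    wordProd B (u ++ v) = wordProd B v * wordProd B u := by
  simp [wordProd]

lemma wordProd_cons (B : Fin 2 → Mat2) (a : Fin 2) (u : Word) :
    wordProd B (a :: u) = wordProd B u * B a := by
  simp [wordProd]

lemma wordProd_power (B : Fin 2 → Mat2) (u : Word) (n : ℕ) :
    wordProd B (List.replicate n u).flatten = wordProd B u ^ n := by
  induction n with
  | zero => simp [wordProd]
  | succ n ih => rw [List.replicate_succ, List.flatten_cons, wordProd_append, ih, pow_succ]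

lemma wordProd_replicate (B : Fin 2 → Mat2) (a : Fin 2) (n : ℕ) :
    wordProd B (List.replicate n a) = B a ^ n := by
  simp [wordProd]

lemma isUnit_wordProd {B : Fin 2 → Mat2} (hB : ∀ k, IsUnit (B k)) (u : Word) :
    IsUnit (wordProd B u) := by
  induction u with
  | nil => simp [wordProd]
  | cons a u ih => rw [wordProd_cons]; exact ih.mul (hB a)

lemma wordProd_scaled (A : Fin 2 → Mat2) (α : ℝ) (u : Word) :
    wordProd (scaled A α) u = α ^ ones u • wordProd A u := by
  induction u with
  | nil => simp [wordProd, ones]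
  | cons a u ih =>
    rw [wordProd_cons, wordProd_cons, ih]
    fin_cases a
    · simp [scaled, ones]
    · simp [scaled, ones, pow_succ, mul_comm, smul_smul]

/-- The logarithmic norm of the product of `A` along a word. -/
noncomputable def logPotential (A : Fin 2 → Mat2) (u : Word) : ℝ := logNorm (wordProd A u)

variable {A : Fin 2 → Mat2}

lemma subadditivePotential_logPotential (hA : ∀ k, IsUnit (A k)) :
    SubadditivePotential (logPotential A) (fun k => Real.log (specRad (A k))) where
  append_le u v := by
    rw [logPotential, wordProd_append, add_comm]
    exact logNorm_mul_le (isUnit_wordProd hA _) (isUnit_wordProd hA _)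
  tendsto_const a := by
    simpa only [logPotential, wordProd_replicate] using tendsto_logNorm_pow (hA a)

lemma tilt_logPotential (hA : ∀ k, IsUnit (A k)) (s : ℝ) (u : Word) :
    tilt (logPotential A) s u = logNorm (wordProd (scaled A (Real.exp s)) u) := by
  rw [wordProd_scaled, logNorm_smul (by positivity) (isUnit_wordProd hA u).ne_zero, Real.log_pow,
    Real.log_exp, tilt, logPotential]
  ring

lemma isUnit_scaled (hA : ∀ k, IsUnit (A k)) {α : ℝ} (hα : 0 < α) (k : Fin 2) :
    IsUnit (scaled A α k) := by
  fin_cases k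
  · exact hA 0
  · exact (hA 1).smul (Units.mk0 α hα.ne')

/-- Two sequences at bounded distance have the same growth rate. -/
lemma tendsto_div_of_abs_sub_le {a b : ℕ → ℝ} {C c : ℝ} (h : ∀ n, |a n - b n| ≤ C)
    (hb : Tendsto (fun n : ℕ => b n / n) atTop (𝓝 c)) :
    Tendsto (fun n : ℕ => a n / n) atTop (𝓝 c) := by
  have h0 : Tendsto (fun n : ℕ => (a n - b n) / n) atTop (𝓝 0) := by
    refine squeeze_zero_norm (fun n => ?_) (tendsto_const_div_atTop_nhds_zero_nat C)
    rw [norm_div, Real.norm_eq_abs, Real.norm_natCast]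
    exact div_le_div_of_nonneg_right (h n) n.cast_nonneg
  have := h0.add hb
  rw [zero_add] at this
  refine this.congr fun n => ?_
  ring

section JointSpectralRadius

variable {N : Seminorm ℝ Mat2}

lemma seminorm_pos (hN : ∀ M : Mat2, N M = 0 → M = 0) {M : Mat2} (hM : IsUnit M) : 0 < N M :=
  lt_of_le_of_ne (apply_nonneg N M) fun h => hM.ne_zero (hN M h.symm)

lemma rpow_one_div_eq_exp {x : ℝ} (hx : 0 < x) (n : ℕ) :
    x ^ (1 / (n : ℝ)) = Real.exp (Real.log x / n) := by
  rw [Real.rpow_def_of_pos hx]; ring_nf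

lemma jointSpecRad_scaled_exp (hN : ∀ M : Mat2, N M = 0 → M = 0) (hA : ∀ k, IsUnit (A k)) (s : ℝ) :
    jointSpecRad N (scaled A (Real.exp s)) = Real.exp (pressure (logPotential A) s) := by
  obtain ⟨C, hC⟩ := exists_abs_log_sub_logNorm_le N hN
  have hunit := fun u => isUnit_wordProd (isUnit_scaled hA (Real.exp_pos s)) u
  set b : ℕ → ℝ := fun n => (Finset.univ : Finset (Fin n → Fin 2)).sup' Finset.univ_nonempty
    fun w => Real.log (N (wordProd (scaled A (Real.exp s)) (List.ofFn w))) with hb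
  have hbt : ∀ n, |b n - tiltMax (logPotential A) s n| ≤ C := by
    intro n
    have hw : ∀ w : Fin n → Fin 2,
        |Real.log (N (wordProd (scaled A (Real.exp s)) (List.ofFn w))) -
          tilt (logPotential A) s (List.ofFn w)| ≤ C := fun w => by
      rw [tilt_logPotential hA]
      exact hC _ (hunit _).ne_zero
    rw [abs_sub_le_iff]
    constructor
    · rw [sub_le_iff_le_add]
      refine Finset.sup'_le _ _ fun w hmem => ?_
      have h1 := (abs_sub_le_iff.1 (hw w)).1
      have h2 := Finset.le_sup' (fun w => tilt (logPotential A) s (List.ofFn w)) hmem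
      rw [tiltMax]
      linarith
    · rw [sub_le_iff_le_add]
      refine Finset.sup'_le _ _ fun w hmem => ?_
      have h1 := (abs_sub_le_iff.1 (hw w)).2
      have h2 := Finset.le_sup' (fun w =>
        Real.log (N (wordProd (scaled A (Real.exp s)) (List.ofFn w)))) hmem
      rw [hb]
      linarith
  have hlim := (Real.continuous_exp.tendsto _).comp
    (tendsto_div_of_abs_sub_le hbt ((subadditivePotential_logPotential hA).tendsto_pressure s))
  refine Tendsto.limUnder_eq (hlim.congr fun n => ?_)
  have hmono : Monotone fun t : ℝ => Real.exp (t / n) := fun x y hxy =>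
    Real.exp_le_exp.2 (div_le_div_of_nonneg_right hxy n.cast_nonneg)
  rw [Function.comp_apply]
  refine (Finset.apply_sup'_eq_sup'_comp Finset.univ_nonempty (fun t : ℝ => Real.exp (t / n))
    fun x y => hmono.map_max).trans ?_
  refine Finset.sup'_congr _ rfl fun w _ => ?_
  rw [Function.comp_apply, rpow_one_div_eq_exp (seminorm_pos hN (hunit _))]

lemma weaklyExtremal_scaled_exp_iff (hN : ∀ M : Mat2, N M = 0 → M = 0) (hA : ∀ k, IsUnit (A k))
    (s : ℝ) (x : InfWord) :
    WeaklyExtremal N (scaled A (Real.exp s)) x ↔ Attains (logPotential A) s x := by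
  obtain ⟨C, hC⟩ := exists_abs_log_sub_logNorm_le N hN
  have hunit := fun u => isUnit_wordProd (isUnit_scaled hA (Real.exp_pos s)) u
  have hC' : ∀ n, |Real.log (N (seqProd (scaled A (Real.exp s)) x n)) -
      tilt (logPotential A) s (pre x n)| ≤ C := fun n => by
    rw [tilt_logPotential hA]
    exact hC _ (hunit _).ne_zero
  have hexp : ∀ n : ℕ, N (seqProd (scaled A (Real.exp s)) x n) ^ (1 / (n : ℝ)) =
      Real.exp (Real.log (N (seqProd (scaled A (Real.exp s)) x n)) / n) := fun n =>
    rpow_one_div_eq_exp (seminorm_pos hN (hunit _)) n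
  rw [WeaklyExtremal, jointSpecRad_scaled_exp hN hA]
  simp only [hexp]
  constructor
  · intro h
    have h1 := h.log (Real.exp_pos _).ne'
    simp only [Real.log_exp] at h1
    exact tendsto_div_of_abs_sub_le (fun n => by rw [abs_sub_comm]; exact hC' n) h1
  · intro h
    exact (Real.continuous_exp.tendsto _).comp (tendsto_div_of_abs_sub_le hC' h)

lemma tendsto_seminorm_pow (hN : ∀ M : Mat2, N M = 0 → M = 0) {M : Mat2} (hM : IsUnit M) :
    Tendsto (fun n : ℕ => N (M ^ n) ^ (1 / (n : ℝ))) atTop (𝓝 (specRad M)) := by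
  obtain ⟨C, hC⟩ := exists_abs_log_sub_logNorm_le N hN
  have h1 := tendsto_div_of_abs_sub_le (fun n => hC _ (hM.pow n).ne_zero) (tendsto_logNorm_pow hM)
  have h2 := (Real.continuous_exp.tendsto _).comp h1
  rw [Real.exp_log (specRad_pos hM)] at h2
  exact h2.congr fun n => (rpow_one_div_eq_exp (seminorm_pos hN (hM.pow n)) n).symm

lemma jointSpecRad_scaled_zero (hN : ∀ M : Mat2, N M = 0 → M = 0) (hA : IsUnit (A 0)) :
    jointSpecRad N (scaled A 0) = specRad (A 0) := by
  refine Tendsto.limUnder_eq ((tendsto_seminorm_pow hN hA).congr' ?_)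
  filter_upwards [eventually_gt_atTop 0] with n hn
  have hn' : (1 / (n : ℝ)) ≠ 0 := by positivity
  refine le_antisymm ?_ (Finset.sup'_le _ _ fun w _ => ?_)
  · refine le_trans (le_of_eq ?_) (Finset.le_sup' (fun w : Fin n → Fin 2 =>
      N (wordProd (scaled A 0) (List.ofFn w)) ^ (1 / (n : ℝ))) (Finset.mem_univ fun _ => 0))
    rw [List.ofFn_const, wordProd_replicate]
    simp [scaled]
  · rw [wordProd_scaled]
    rcases Nat.eq_zero_or_pos (ones (List.ofFn w)) with h0 | h0
    · have := eq_replicate_zero h0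
      rw [List.length_ofFn] at this
      rw [h0, this, wordProd_replicate, pow_zero, one_smul]
    · rw [zero_pow h0.ne', zero_smul, map_zero, Real.zero_rpow hn']
      exact Real.rpow_nonneg (apply_nonneg N _) _

lemma ratio_zero (hN : ∀ M : Mat2, N M = 0 → M = 0) (hA : IsUnit (A 0)) {r : ℝ → ℝ}
    (hr : IsOneRatioFunction N A r) : r 0 = 0 := by
  have h1 : WeaklyExtremal N (scaled A 0) (fun _ => 0) := by
    rw [WeaklyExtremal, jointSpecRad_scaled_zero hN hA]
    refine (tendsto_seminorm_pow hN hA).congr fun n => ?_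
    rw [seqProd, pre_const, wordProd_replicate]
    simp [scaled]
  refine tendsto_nhds_unique (hr.ratio 0 le_rfl _ h1) ?_
  simp [pre_const, ones, List.count_replicate]

lemma sturmianPotential_logPotential (hN : ∀ M : Mat2, N M = 0 → M = 0) (hA : ∀ k, IsUnit (A k))
    {r : ℝ → ℝ} (hr : IsOneRatioFunction N A r) :
    SturmianPotential (logPotential A) (fun k => Real.log (specRad (A k)))
      (fun s => r (Real.exp s)) where
  toSubadditivePotential := subadditivePotential_logPotential hA
  mem_Icc s := hr.mem_Icc _ (Real.exp_pos s).le
  attains s x hx := (weaklyExtremal_scaled_exp_iff hN hA s x).1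
    (hr.extremal _ (Real.exp_pos s).le x hx)
  ratio s x hx := hr.ratio _ (Real.exp_pos s).le x
    ((weaklyExtremal_scaled_exp_iff hN hA s x).2 hx)

end JointSpectralRadius

lemma log_specRad_wordProd_scaled_exp (hA : ∀ k, IsUnit (A k)) (s : ℝ) (u : Word) :
    Real.log (specRad (wordProd (scaled A (Real.exp s)) u)) =
      Real.log (specRad (wordProd A u)) + s * ones u := by
  refine tendsto_nhds_unique
    (tendsto_logNorm_pow (isUnit_wordProd (isUnit_scaled hA (Real.exp_pos s)) u))
    (((tendsto_logNorm_pow (isUnit_wordProd hA u)).add_const (s * ones u)).congr' ?_)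
  filter_upwards [eventually_gt_atTop 0] with n hn
  have hn' : (n : ℝ) ≠ 0 := by exact_mod_cast hn.ne'
  rw [← wordProd_power, ← wordProd_power, ← tilt_logPotential hA, tilt, logPotential]
  simp only [ones, List.count_flatten, List.map_replicate, List.sum_replicate, smul_eq_mul]
  push_cast
  field_simp

lemma slope_mem_Icc (u : Word) : slope u ∈ Set.Icc (0 : ℝ) 1 :=
  ⟨by unfold slope; positivity, div_le_one_of_le₀ (by exact_mod_cast ones_le_length u)
    (Nat.cast_nonneg _)⟩

lemma cyclicallyBalanced_replicate (a : Fin 2) (n : ℕ) :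
    CyclicallyBalanced (List.replicate n a) := by
  rintro v ⟨k, rfl⟩ w w' hw hw' hlen
  rw [List.rotate_replicate] at hw hw'
  have key : ∀ z : Word, z <:+: List.replicate n a → z = List.replicate z.length a := fun z hz =>
    List.eq_replicate_iff.2 ⟨rfl, fun b hb => List.eq_of_mem_replicate (hz.subset hb)⟩
  rw [key w hw, key w' hw', hlen]
  simp

lemma slope_mem_Ioo {u : Word} (hu : 0 < u.length) (hc : ¬ CyclicallyBalanced u) :
    slope u ∈ Set.Ioo (0 : ℝ) 1 := by
  have hu' : (u.length : ℝ) ≠ 0 := by exact_mod_cast hu.ne'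
  refine ⟨lt_of_le_of_ne (slope_mem_Icc u).1 fun h => hc ?_,
    lt_of_le_of_ne (slope_mem_Icc u).2 fun h => hc ?_⟩
  · have h0 : ones u = 0 := by
      rw [slope, eq_comm, div_eq_zero_iff] at h
      exact_mod_cast h.resolve_right hu'
    rw [eq_replicate_zero h0]
    exact cyclicallyBalanced_replicate _ _
  · have h1 : ones u = u.length := by
      rw [slope, div_eq_one_iff_eq hu'] at h
      exact_mod_cast h
    rw [eq_replicate_one h1]
    exact cyclicallyBalanced_replicate _ _

lemma log_specRad_div_le_dual (hA : ∀ k, IsUnit (A k)) {u : Word} (hu : 0 < u.length) :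
    Real.log (specRad (wordProd A u)) / u.length ≤ dual (logPotential A) (slope u) := by
  have hu' : (0 : ℝ) < u.length := by exact_mod_cast hu
  refine SubadditivePotential.le_dual fun s => ?_
  have h := (subadditivePotential_logPotential hA).power_rate_le s hu
    (c := Real.log (specRad (wordProd A u)))
    (by simpa only [logPotential, wordProd_power] using
      tendsto_logNorm_pow (isUnit_wordProd hA u))
  rw [div_le_iff₀ hu', slope, sub_mul, mul_assoc, div_mul_cancel₀ _ hu'.ne']
  linarith

lemma log_specRad_div_eq_dual_iff {N : Seminorm ℝ Mat2} (hN : ∀ M : Mat2, N M = 0 → M = 0)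
    (hA : ∀ k, IsUnit (A k)) {r : ℝ → ℝ} (hr : IsOneRatioFunction N A r) {u : Word}
    (hu : 0 < u.length) :
    Real.log (specRad (wordProd A u)) / u.length = dual (logPotential A) (slope u) ↔
      CyclicallyBalanced u := by
  have hu' : (0 : ℝ) < u.length := by exact_mod_cast hu
  have hS := sturmianPotential_logPotential hN hA hr
  constructor
  · contrapose
    intro hc
    obtain ⟨s, hs⟩ := hS.exists_eq (slope_mem_Ioo hu hc)
    have h1 := hr.lt_of_not_balanced _ (Real.exp_pos s).le u hc
    rw [jointSpecRad_scaled_exp hN hA] at h1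
    have h2 := Real.log_lt_log
      (specRad_pos (isUnit_wordProd (isUnit_scaled hA (Real.exp_pos s)) u)) h1
    rw [log_specRad_wordProd_scaled_exp hA, Real.log_pow, Real.log_exp] at h2
    refine ne_of_lt ?_
    rw [(hS.dual_eq_iff (slope_mem_Icc u) s).2 hs, div_lt_iff₀ hu', slope, sub_mul, mul_assoc,
      div_mul_cancel₀ _ hu'.ne']
    linarith
  · intro hc
    have h1 := (hS.tendsto_dual (slope_mem_Icc u) (periodic_mem_X hu hc)).comp
      (tendsto_id.atTop_mul_const' hu)
    refine tendsto_nhds_unique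
      ((tendsto_logNorm_pow (isUnit_wordProd hA u)).div_const (u.length : ℝ)) (h1.congr fun n => ?_)
    simp only [Function.comp_apply, id, pre_periodic_mul, logPotential, wordProd_power]
    push_cast
    rw [div_div]

end SturmianPair

theorem proposition3p3
    (N : Seminorm ℝ SturmianPair.Mat2) (hN : ∀ M : SturmianPair.Mat2, N M = 0 → M = 0)
    (A : Fin 2 → SturmianPair.Mat2) (hA : SturmianPair.TechnicalHypotheses A)
    (r : ℝ → ℝ) (hr : SturmianPair.IsOneRatioFunction N A r) :
    ∃ S : ℝ → ℝ,
      ContinuousOn S (Set.Icc 0 1) ∧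
      ConcaveOn ℝ (Set.Icc 0 1) S ∧
      (∀ γ ∈ Set.Icc (0 : ℝ) 1, ∀ x ∈ SturmianPair.X γ,
        Tendsto (fun n : ℕ => 1 / (n : ℝ) * Real.log (N (SturmianPair.seqProd A x n)))
          atTop (𝓝 (S γ))) ∧
      (∀ α : ℝ, 0 ≤ α → ∀ γ ∈ Set.Icc (0 : ℝ) 1,
        Real.exp (S γ) * α ^ γ ≤ SturmianPair.jointSpecRad N (SturmianPair.scaled A α) ∧
        (Real.exp (S γ) * α ^ γ = SturmianPair.jointSpecRad N (SturmianPair.scaled A α) ↔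
          γ = r α)) ∧
      (∀ α : ℝ, 0 < α → ∀ γ ∈ Set.Icc (0 : ℝ) 1,
        (r α = γ ↔ SturmianPair.IsSubgradient S γ (-Real.log α))) ∧
      (∀ (p q k : ℕ) (u : SturmianPair.Word), 0 < q → 0 < k → u.length = k * q →
        SturmianPair.slope u = (p : ℝ) / (q : ℝ) →
        1 / ((k : ℝ) * (q : ℝ)) * Real.log (SturmianPair.specRad (SturmianPair.wordProd A u)) ≤
            S ((p : ℝ) / (q : ℝ)) ∧
        (1 / ((k : ℝ) * (q : ℝ)) * Real.log (SturmianPair.specRad (SturmianPair.wordProd A u)) =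
            S ((p : ℝ) / (q : ℝ)) ↔ SturmianPair.CyclicallyBalanced u)) := by
  open SturmianPair in
  have hinv := hA.invertible
  have hS := sturmianPotential_logPotential hN hinv hr
  refine ⟨dual (logPotential A), hS.continuousOn_dual, hS.concaveOn_dual, ?_, ?_, ?_, ?_⟩
  · intro γ hγ x hx
    obtain ⟨C, hC⟩ := exists_abs_log_sub_logNorm_le N hN
    refine (tendsto_div_of_abs_sub_le (fun n => hC _ (isUnit_wordProd hinv (pre x n)).ne_zero)
      (hS.tendsto_dual hγ hx)).congr fun n => ?_
    rw [seqProd]; ring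
  · intro α hα γ hγ
    rcases hα.eq_or_lt with rfl | hα
    · rw [jointSpecRad_scaled_zero hN (hinv 0), ratio_zero hN (hinv 0) hr]
      have hpos := specRad_pos (hinv 0)
      rcases eq_or_ne γ 0 with rfl | hne
      · simp [hS.dual_zero, Real.exp_log hpos]
      · simp [Real.zero_rpow hne, hne, hpos.le, hpos.ne]
    · obtain ⟨s, rfl⟩ : ∃ s, Real.exp s = α := ⟨_, Real.exp_log hα⟩
      rw [jointSpecRad_scaled_exp hN hinv, ← Real.exp_mul, ← Real.exp_add, Real.exp_le_exp,
        Real.exp_eq_exp, ← hS.dual_eq_iff hγ s]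
      exact ⟨by linarith [hS.dual_le hγ s], eq_sub_iff_add_eq.symm⟩
  · intro α hα γ hγ
    have := hS.isSubgradient_iff hγ (Real.log α)
    rwa [Real.exp_log hα] at this
  · intro p q k u hq hk hlen hslope
    have hu : 0 < u.length := by rw [hlen]; positivity
    have e : 1 / ((k : ℝ) * q) * Real.log (specRad (wordProd A u)) =
        Real.log (specRad (wordProd A u)) / u.length := by
      rw [hlen]; push_cast; ring
    rw [← hslope, e]
    exact ⟨log_specRad_div_le_dual hinv hu, log_specRad_div_eq_dual_iff hN hinv hr hu⟩
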